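/- Let $M$ be a connected smooth $2$-manifold and let $x : M \to \mathbb{S}^3 \subset \mathbb{R}^4$ be a smooth immersion, oriented by a smooth unit normal field $e_3 : M \to \mathbb{R}^4$ (so $\langle e_3, x\rangle = 0$ and $\langle e_3, dx(v)\rangle = 0$ for all tangent vectors $v$). Let $\mathrm{I}(v,w) = \langle dx(v), dx(w)\rangle$ and $\mathrm{II}(v,w) = -\langle de_3(v), dx(w)\rangle$ be its first and second fundamental forms, and let the principal curvatures $\lambda_1(p), \lambda_2(p)$ be the diagonal entries of $\mathrm{II}_p$ in an $\mathrm{I}_p$-orthonormal basis of $T_pM$ that diagonalizes $\mathrm{II}_p$. Let $K$ be the Gaussian curvature of the induced metric, that is, $d\omega_2^1 = K\,\theta^1\wedge\theta^2$ for a local orthonormal tangent frame $(e_1,e_2)$ with dual coframe $(\theta^1,\theta^2)$ and connection form $\omega_2^1 = \langle de_2, e_1\rangle$. If the surface is totally umbilic, i.e. $\lambda_1(p) = \lambda_2(p)$ for every $p \in M$, then $d\lambda_1 = d\lambda_2 = 0$ on $M$, and there is a constant $\lambda \in \mathbb{R}$ with $\lambda_1 = \lambda_2 = \lambda$ on all of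 $M$. Moreover $K = 1 + \lambda_1\lambda_2 = 1 + \lambda^2$, so $K$ is constant as well. -/

import Mathlib

open scoped Manifold ContDiff RealInnerProductSpace

noncomputable section

namespace SphereSurface

/-- The coordinate plane `ℝ²`. -/
abbrev E2 := EuclideanSpace ℝ (Fin 2)

/-- The ambient space `ℝ⁴`, with its Euclidean inner product. -/
abbrev E4 := EuclideanSpace ℝ (Fin 4)

/-- A regular oriented surface in the unit sphere `𝕊³ ⊂ ℝ⁴`: a smooth immersion `pos` of a smooth
`2`-manifold `M` with values in `𝕊³`, together with a smooth unit normal field `normal` (the vector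
`e₃` of adapted frames) which is tangent to `𝕊³` and orthogonal to the surface. As `𝕊³` is oriented,
the choice of an orientation of the surface is the choice of such a field. -/
structure OrientedSurface (M : Type*) [TopologicalSpace M] [ChartedSpace E2 M]
    [IsManifold (𝓡 2) ∞ M] where
  pos : M → E4
  contMDiff_pos : ContMDiff (𝓡 2) 𝓘(ℝ, E4) ∞ pos
  pos_mem_sphere : ∀ p, pos p ∈ Metric.sphere (0 : E4) 1
  immersion : ∀ p, Function.Injective (mfderiv (𝓡 2) 𝓘(ℝ, E4) pos p)
  normal : M → E4
  contMDiff_normal : ContMDiff (𝓡 2) 𝓘(ℝ, E4) ∞ normal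
  norm_normal : ∀ p, ‖normal p‖ = 1
  normal_tangent_sphere : ∀ p, ⟪normal p, pos p⟫ = 0
  normal_orthogonal : ∀ (p : M) (v : TangentSpace (𝓡 2) p),
    ⟪normal p, (mfderiv (𝓡 2) 𝓘(ℝ, E4) pos p v : E4)⟫ = 0

namespace OrientedSurface

variable {M : Type*} [TopologicalSpace M] [ChartedSpace E2 M] [IsManifold (𝓡 2) ∞ M]

/-- The differential of the immersion at `p`. -/
def dpos (S : OrientedSurface M) (p : M) (v : TangentSpace (𝓡 2) p) : E4 :=
  mfderiv (𝓡 2) 𝓘(ℝ, E4) S.pos p v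

/-- The differential of the unit normal at `p`. -/
def dnormal (S : OrientedSurface M) (p : M) (v : TangentSpace (𝓡 2) p) : E4 :=
  mfderiv (𝓡 2) 𝓘(ℝ, E4) S.normal p v

/-- The first fundamental form (induced metric) at `p`. -/
def firstForm (S : OrientedSurface M) (p : M) (v w : TangentSpace (𝓡 2) p) : ℝ :=
  ⟪S.dpos p v, S.dpos p w⟫

/-- The second fundamental form at `p`. For an adapted frame `e₁, e₂, e₃` with `e₃` the normal, one
has `ω_i³ = ⟨de_i, e₃⟩ = -⟨e_i, de₃⟩`, so that `h_{ij} = ω_i³(e_j) = -⟨de₃(e_j), e_i⟩`. -/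
def secondForm (S : OrientedSurface M) (p : M) (v w : TangentSpace (𝓡 2) p) : ℝ :=
  -⟪S.dnormal p v, S.dpos p w⟫

/-- `κ₁, κ₂` are the principal curvatures at `p` (listed with multiplicity): in some basis of the
tangent plane that is orthonormal for the first fundamental form, the matrix of the second
fundamental form is diagonal with entries `κ₁, κ₂`. -/
def IsPrincipalCurvatures (S : OrientedSurface M) (p : M) (κ₁ κ₂ : ℝ) : Prop :=
  ∃ e₁ e₂ : TangentSpace (𝓡 2) p,
    (S.firstForm p e₁ e₁ = 1 ∧ S.firstForm p e₂ e₂ = 1 ∧ S.firstForm p e₁ e₂ = 0) ∧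
    S.secondForm p e₁ e₁ = κ₁ ∧ S.secondForm p e₂ e₂ = κ₂ ∧
    S.secondForm p e₁ e₂ = 0 ∧ S.secondForm p e₂ e₁ = 0

/-- The local parametrization of the surface by the preferred chart at `p`. -/
def localPos (S : OrientedSurface M) (p : M) : E2 → E4 :=
  S.pos ∘ (extChartAt (𝓡 2) p).symm

/-- The `i`-th coordinate vector `∂_i` of `ℝ²`. -/
def coord (i : Fin 2) : E2 := EuclideanSpace.single i 1

/-- The local orthonormal tangent frame `(e₁, e₂)` obtained by applying the Gram-Schmidt process to
the coordinate tangent vectors of the parametrization. -/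
def frame (S : OrientedSurface M) (p : M) (i : Fin 2) (u : E2) : E4 :=
  InnerProductSpace.gramSchmidtNormed ℝ (fun j => fderiv ℝ (S.localPos p) u (coord j)) i

/-- The dual coframe `θ^i(v) = ⟨dx(v), e_i⟩`. -/
def coframe (S : OrientedSurface M) (p : M) (i : Fin 2) (u v : E2) : ℝ :=
  ⟪fderiv ℝ (S.localPos p) u v, S.frame p i u⟫

/-- The connection form `ω_2^1 = ⟨de₂, e₁⟩` of the frame. -/
def connectionForm (S : OrientedSurface M) (p : M) (u v : E2) : ℝ :=
  ⟪fderiv ℝ (S.frame p 1) u v, S.frame p 0 u⟫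

/-- The value `dω_2^1(∂₁, ∂₂) = ∂₁(ω_2^1(∂₂)) - ∂₂(ω_2^1(∂₁))`. -/
def dConnectionForm (S : OrientedSurface M) (p : M) (u : E2) : ℝ :=
  fderiv ℝ (fun y => S.connectionForm p y (coord 1)) u (coord 0)
    - fderiv ℝ (fun y => S.connectionForm p y (coord 0)) u (coord 1)

/-- The value `(θ^1 ∧ θ^2)(∂₁, ∂₂)`. -/
def areaForm (S : OrientedSurface M) (p : M) (u : E2) : ℝ :=
  S.coframe p 0 u (coord 0) * S.coframe p 1 u (coord 1)
    - S.coframe p 0 u (coord 1) * S.coframe p 1 u (coord 0)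

/-- The Gaussian curvature of the induced metric at `p`: the number `K` such that
`dω_2^1 = K θ^1 ∧ θ^2` at `p` (the form `θ^1 ∧ θ^2` does not vanish there). -/
def gaussianCurvature (S : OrientedSurface M) (p : M) : ℝ :=
  S.dConnectionForm p (extChartAt (𝓡 2) p p) / S.areaForm p (extChartAt (𝓡 2) p p)

end OrientedSurface

end SphereSurface

end

open Filter Topology

namespace SphereSurface

open OrientedSurface (coord)

/-! Write `X` and `N` for the immersion and the normal read in a chart. Differentiating the constant
inner products of `X` and `N` shows that `dN` is tangent to the surface, so equal principal
curvatures mean `dN = -λ dX` (`dnormal_eq_smul_dpos`). Differentiate this relation again and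
antisymmetrize. Second derivatives are symmetric, so what remains is `dλ(v) dX(w) = dλ(w) dX(v)`. As
`dX` is injective and the domain is two-dimensional, `dλ = 0` (`hasFDerivAt_zero_of_umbilic`).
Connectedness then makes `λ` constant. For the curvature, `dω_2^1` is the antisymmetrization of
`⟪de₂, de₁⟫`, expanded in the orthonormal basis `e₁, e₂, N, X`. The tangential terms vanish because
the `eᵢ` are unit vectors, `N` contributes `λ²` and `X` contributes `1`
(`gauss_equation_of_umbilic`). This is pointwise: the constancy of `λ` plays no role in it. -/

lemma two_le_smooth : (2 : ℕ∞ω) ≤ ∞ :=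
  WithTop.coe_le_coe.mpr (le_top : (2 : ℕ∞) ≤ ⊤)

/-! ### Linear algebra at an umbilic point. -/

lemma exists_orthonormalBasis_of_four {a b c d : E4} (ha : ⟪a, a⟫ = 1) (hb : ⟪b, b⟫ = 1)
    (hc : ⟪c, c⟫ = 1) (hd : ⟪d, d⟫ = 1) (hab : ⟪a, b⟫ = 0) (hac : ⟪a, c⟫ = 0) (had : ⟪a, d⟫ = 0)
    (hbc : ⟪b, c⟫ = 0) (hbd : ⟪b, d⟫ = 0) (hcd : ⟪c, d⟫ = 0) :
    ∃ B : OrthonormalBasis (Fin 4) ℝ E4, ⇑B = ![a, b, c, d] := by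
  have hon : Orthonormal ℝ ![a, b, c, d] := by
    rw [orthonormal_iff_ite]
    intro i j
    fin_cases i <;> fin_cases j <;>
      simp [ha, hb, hc, hd, hab, hac, had, hbc, hbd, hcd, real_inner_comm a, real_inner_comm b,
        real_inner_comm c, -inner_self_eq_norm_sq_to_K]
  have hcard : Fintype.card (Fin 4) = Module.finrank ℝ E4 := by simp
  refine ⟨(basisOfOrthonormalOfCardEqFinrank hon hcard).toOrthonormalBasis (by simpa using hon), ?_⟩
  simp

/-- Parseval's identity for an orthonormal quadruple in `ℝ⁴`. -/
lemma inner_eq_of_four {a b c d : E4} (ha : ⟪a, a⟫ = 1) (hb : ⟪b, b⟫ = 1)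
    (hc : ⟪c, c⟫ = 1) (hd : ⟪d, d⟫ = 1) (hab : ⟪a, b⟫ = 0) (hac : ⟪a, c⟫ = 0) (had : ⟪a, d⟫ = 0)
    (hbc : ⟪b, c⟫ = 0) (hbd : ⟪b, d⟫ = 0) (hcd : ⟪c, d⟫ = 0) (x y : E4) :
    ⟪x, y⟫ = ⟪x, a⟫ * ⟪y, a⟫ + ⟪x, b⟫ * ⟪y, b⟫ + ⟪x, c⟫ * ⟪y, c⟫ + ⟪x, d⟫ * ⟪y, d⟫ := by
  obtain ⟨B, hB⟩ := exists_orthonormalBasis_of_four ha hb hc hd hab hac had hbc hbd hcd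
  rw [← B.sum_inner_mul_inner x y, Fin.sum_univ_four, hB]
  simp [real_inner_comm y]

/-- At an umbilic point the differential of the normal is a multiple of that of the immersion. -/
lemma dnormal_eq_smul_dpos {A B : E2 →L[ℝ] E4} {x n : E4} {e₁ e₂ : E2} {r : ℝ}
    (hx : ⟪x, x⟫ = 1) (hn : ⟪n, n⟫ = 1) (hnx : ⟪n, x⟫ = 0)
    (hAx : ∀ v, ⟪A v, x⟫ = 0) (hAn : ∀ v, ⟪A v, n⟫ = 0)
    (hBx : ∀ v, ⟪B v, x⟫ = 0) (hBn : ∀ v, ⟪B v, n⟫ = 0)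
    (h11 : ⟪A e₁, A e₁⟫ = 1) (h22 : ⟪A e₂, A e₂⟫ = 1) (h12 : ⟪A e₁, A e₂⟫ = 0)
    (k11 : -⟪B e₁, A e₁⟫ = r) (k22 : -⟪B e₂, A e₂⟫ = r)
    (k12 : -⟪B e₁, A e₂⟫ = 0) (k21 : -⟪B e₂, A e₁⟫ = 0) : B = -r • A := by
  -- `B v + r • A v` is orthogonal to `n` and `x`; once it is also orthogonal to `A e₁` and `A e₂`,
  -- Parseval makes its norm zero.
  have key : ∀ v, ⟪B v + r • A v, A e₁⟫ = 0 → ⟪B v + r • A v, A e₂⟫ = 0 → B v = (-r • A) v := by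
    intro v h1 h2
    have h0 := inner_eq_of_four h11 h22 hn hx h12 (hAn e₁) (hAx e₁) (hAn e₂) (hAx e₂) hnx
      (B v + r • A v) (B v + r • A v)
    rw [h1, h2] at h0
    simp only [inner_add_left, inner_smul_left, hBn, hAn, hBx, hAx] at h0
    have : B v + r • A v = 0 := by
      rw [← inner_self_eq_zero (𝕜 := ℝ)]
      simp only [inner_add_left, inner_smul_left]
      simpa using h0
    simpa using eq_neg_of_add_eq_zero_left this
  have h21 : ⟪A e₂, A e₁⟫ = 0 := by rw [real_inner_comm, h12]
  have hb1 := key e₁ (by simp only [inner_add_left, real_inner_smul_left]; rw [h11]; linarith)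
    (by simp only [inner_add_left, real_inner_smul_left]; rw [h12]; linarith)
  have hb2 := key e₂ (by simp only [inner_add_left, real_inner_smul_left]; rw [h21]; linarith)
    (by simp only [inner_add_left, real_inner_smul_left]; rw [h22]; linarith)
  have hli : LinearIndependent ℝ ![e₁, e₂] := by
    rw [LinearIndependent.pair_iff]
    intro s t hst
    have h := congrArg A hst
    simp only [map_add, map_smul, map_zero] at h
    have e1 := congrArg (fun z => ⟪z, A e₁⟫) h
    have e2 := congrArg (fun z => ⟪z, A e₂⟫) h
    simp only [inner_add_left, real_inner_smul_left, h11, h22, h12, h21, inner_zero_left] at e1 e2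
    constructor <;> linarith
  let b := basisOfLinearIndependentOfCardEqFinrank hli (by simp)
  apply ContinuousLinearMap.coe_injective
  refine b.ext fun i => ?_
  fin_cases i
  · simpa [b] using hb1
  · simpa [b] using hb2

/-! ### Parametrized patches: the Codazzi and Gauss equations. -/

lemma inner_fderiv_add_inner_fderiv_eq_zero {U : Set E2} (hU : IsOpen U) {f g : E2 → E4} {c : ℝ}
    (h : ∀ y ∈ U, ⟪f y, g y⟫ = c) {u : E2} (hu : u ∈ U) (hf : DifferentiableAt ℝ f u)
    (hg : DifferentiableAt ℝ g u) (v : E2) :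
    ⟪f u, fderiv ℝ g u v⟫ + ⟪fderiv ℝ f u v, g u⟫ = 0 := by
  rw [← fderiv_inner_apply ℝ hf hg]
  have : (fun y => ⟪f y, g y⟫) =ᶠ[𝓝 u] fun _ => c := by
    filter_upwards [hU.mem_nhds hu] with y hy using h y hy
  rw [this.fderiv_eq]
  simp

lemma inner_fderiv_self_eq_zero {U : Set E2} (hU : IsOpen U) {f : E2 → E4} {c : ℝ}
    (h : ∀ y ∈ U, ⟪f y, f y⟫ = c) {u : E2} (hu : u ∈ U) (hf : DifferentiableAt ℝ f u) (v : E2) :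
    ⟪fderiv ℝ f u v, f u⟫ = 0 := by
  have := inner_fderiv_add_inner_fderiv_eq_zero hU h hu hf hf v
  rw [real_inner_comm] at this
  linarith

/-- A parametrized surface `X` in the unit sphere of `ℝ⁴` over an open set of the plane, with unit
normal `N`. -/
structure IsPatch (U : Set E2) (X N : E2 → E4) : Prop where
  isOpen : IsOpen U
  contDiffOn_pos : ContDiffOn ℝ ∞ X U
  contDiffOn_normal : ContDiffOn ℝ ∞ N U
  inner_pos_pos : ∀ u ∈ U, ⟪X u, X u⟫ = 1
  inner_normal_normal : ∀ u ∈ U, ⟪N u, N u⟫ = 1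
  inner_normal_pos : ∀ u ∈ U, ⟪N u, X u⟫ = 0
  inner_normal_fderiv : ∀ u ∈ U, ∀ v, ⟪N u, fderiv ℝ X u v⟫ = 0
  injective : ∀ u ∈ U, Function.Injective (fderiv ℝ X u)

namespace IsPatch

variable {U : Set E2} {X N : E2 → E4}

lemma contDiffAt_pos (h : IsPatch U X N) {u : E2} (hu : u ∈ U) : ContDiffAt ℝ ∞ X u :=
  h.contDiffOn_pos.contDiffAt (h.isOpen.mem_nhds hu)

lemma contDiffAt_normal (h : IsPatch U X N) {u : E2} (hu : u ∈ U) : ContDiffAt ℝ ∞ N u :=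
  h.contDiffOn_normal.contDiffAt (h.isOpen.mem_nhds hu)

lemma differentiableAt_pos (h : IsPatch U X N) {u : E2} (hu : u ∈ U) : DifferentiableAt ℝ X u :=
  (h.contDiffAt_pos hu).differentiableAt (by simp)

lemma differentiableAt_normal (h : IsPatch U X N) {u : E2} (hu : u ∈ U) :
    DifferentiableAt ℝ N u :=
  (h.contDiffAt_normal hu).differentiableAt (by simp)

lemma contDiffAt_fderiv_pos (h : IsPatch U X N) {u : E2} (hu : u ∈ U) :
    ContDiffAt ℝ ∞ (fderiv ℝ X) u :=
  (h.contDiffAt_pos hu).fderiv_right (by simp)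

lemma contDiffAt_fderiv_normal (h : IsPatch U X N) {u : E2} (hu : u ∈ U) :
    ContDiffAt ℝ ∞ (fderiv ℝ N) u :=
  (h.contDiffAt_normal hu).fderiv_right (by simp)

lemma fderiv_normal_eq (h : IsPatch U X N) {u : E2} (hu : u ∈ U) {e₁ e₂ : E2} {r : ℝ}
    (h11 : ⟪fderiv ℝ X u e₁, fderiv ℝ X u e₁⟫ = 1) (h22 : ⟪fderiv ℝ X u e₂, fderiv ℝ X u e₂⟫ = 1)
    (h12 : ⟪fderiv ℝ X u e₁, fderiv ℝ X u e₂⟫ = 0)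
    (k11 : -⟪fderiv ℝ N u e₁, fderiv ℝ X u e₁⟫ = r) (k22 : -⟪fderiv ℝ N u e₂, fderiv ℝ X u e₂⟫ = r)
    (k12 : -⟪fderiv ℝ N u e₁, fderiv ℝ X u e₂⟫ = 0)
    (k21 : -⟪fderiv ℝ N u e₂, fderiv ℝ X u e₁⟫ = 0) :
    fderiv ℝ N u = -r • fderiv ℝ X u := by
  have hAn : ∀ v, ⟪fderiv ℝ X u v, N u⟫ = 0 := fun v => by
    rw [real_inner_comm, h.inner_normal_fderiv u hu]
  refine dnormal_eq_smul_dpos (h.inner_pos_pos u hu) (h.inner_normal_normal u hu)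
    (h.inner_normal_pos u hu)
    (inner_fderiv_self_eq_zero h.isOpen h.inner_pos_pos hu (h.differentiableAt_pos hu))
    hAn (fun v => ?_)
    (inner_fderiv_self_eq_zero h.isOpen h.inner_normal_normal hu (h.differentiableAt_normal hu))
    h11 h22 h12 k11 k22 k12 k21
  have := inner_fderiv_add_inner_fderiv_eq_zero h.isOpen h.inner_normal_pos hu
    (h.differentiableAt_normal hu) (h.differentiableAt_pos hu) v
  rwa [h.inner_normal_fderiv u hu, zero_add] at this

/-- The Codazzi equation of a totally umbilic patch: the principal curvature is stationary. -/
lemma hasFDerivAt_zero_of_umbilic (h : IsPatch U X N) {Λ : E2 → ℝ}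
    (hΛ : ∀ u ∈ U, fderiv ℝ N u = -Λ u • fderiv ℝ X u) {u : E2} (hu : u ∈ U) :
    HasFDerivAt Λ (0 : E2 →L[ℝ] ℝ) u := by
  have hne : ∀ y ∈ U, ⟪fderiv ℝ X y (coord 0), fderiv ℝ X y (coord 0)⟫ ≠ 0 := by
    intro y hy h0
    rw [inner_self_eq_zero] at h0
    have := h.injective y hy (h0.trans (map_zero _).symm)
    simp [coord] at this
  -- No regularity of `Λ` is assumed. It is inherited from this quotient of smooth functions.
  have hΛeq : Λ =ᶠ[𝓝 u] fun y => -⟪fderiv ℝ N y (coord 0), fderiv ℝ X y (coord 0)⟫ /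
      ⟪fderiv ℝ X y (coord 0), fderiv ℝ X y (coord 0)⟫ := by
    filter_upwards [h.isOpen.mem_nhds hu] with y hy
    rw [hΛ y hy, eq_div_iff (hne y hy)]
    simp only [smul_apply, real_inner_smul_left]
    ring
  have dX : DifferentiableAt ℝ (fderiv ℝ X) u :=
    (h.contDiffAt_fderiv_pos hu).differentiableAt (by simp)
  have dN : DifferentiableAt ℝ (fderiv ℝ N) u :=
    (h.contDiffAt_fderiv_normal hu).differentiableAt (by simp)
  have hd : DifferentiableAt ℝ Λ u := by
    refine DifferentiableAt.congr_of_eventuallyEq ?_ hΛeq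
    have h1 : DifferentiableAt ℝ (fun y => fderiv ℝ X y (coord 0)) u :=
      dX.clm_apply (differentiableAt_const _)
    have h2 : DifferentiableAt ℝ (fun y => fderiv ℝ N y (coord 0)) u :=
      dN.clm_apply (differentiableAt_const _)
    exact ((h2.inner ℝ h1).neg).fun_mul ((h1.inner ℝ h1).fun_inv (hne u hu))
  have hN2 : fderiv ℝ (fderiv ℝ N) u =
      -(Λ u • fderiv ℝ (fderiv ℝ X) u + (fderiv ℝ Λ u).smulRight (fderiv ℝ X u)) := by
    have hev : fderiv ℝ N =ᶠ[𝓝 u] fun y => -(Λ y • fderiv ℝ X y) := by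
      filter_upwards [h.isOpen.mem_nhds hu] with y hy
      ext1 v
      simp [hΛ y hy]
    rw [hev.fderiv_eq]
    exact (hd.hasFDerivAt.smul dX.hasFDerivAt).neg.fderiv
  have symX := (h.contDiffAt_pos hu).isSymmSndFDerivAt 
    (by simpa using two_le_smooth)
  have symN := (h.contDiffAt_normal hu).isSymmSndFDerivAt 
    (by simpa using two_le_smooth)
  -- The terms with second derivatives of `X` and `N` are symmetric in `v, w` and cancel, and
  -- injectivity of `dX` removes `dX`.
  have hsym : ∀ v w, fderiv ℝ Λ u v • w = fderiv ℝ Λ u w • v := by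
    intro v w
    apply h.injective u hu
    have := symN v w
    rw [hN2] at this
    simp only [neg_apply, add_apply,
      smul_apply, ContinuousLinearMap.smulRight_apply, neg_inj] at this
    rw [symX v w] at this
    simpa using this
  have hz : ∀ v, fderiv ℝ Λ u v = 0 := by
    intro v
    have h1 : fderiv ℝ Λ u (coord 0) = 0 := by
      simpa [coord] using congrFun (congrArg WithLp.ofLp (hsym (coord 0) (coord 1))) 1
    have h2 := congrFun (congrArg WithLp.ofLp (hsym v (coord 0))) 0
    rw [h1] at h2
    simpa [coord] using h2
  have : fderiv ℝ Λ u = 0 := by ext1 v; simpa using hz v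
  rw [← this]
  exact hd.hasFDerivAt

/-- The Gauss equation of a totally umbilic patch in a moving frame. -/
lemma gauss_equation_of_umbilic (h : IsPatch U X N) {r : ℝ} {e : Fin 2 → E2 → E4} {u : E2}
    (hu : u ∈ U) (hr : fderiv ℝ N u = -r • fderiv ℝ X u)
    (he : ∀ i, ContDiffAt ℝ 2 (e i) u) (h00 : ∀ y ∈ U, ⟪e 0 y, e 0 y⟫ = 1)
    (h11 : ∀ y ∈ U, ⟪e 1 y, e 1 y⟫ = 1) (h01 : ∀ y ∈ U, ⟪e 0 y, e 1 y⟫ = 0)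
    (het : ∀ y ∈ U, ∀ i, e i y ∈ Set.range (fderiv ℝ X y)) (a b : E2) :
    fderiv ℝ (fun y => ⟪fderiv ℝ (e 1) y b, e 0 y⟫) u a
      - fderiv ℝ (fun y => ⟪fderiv ℝ (e 1) y a, e 0 y⟫) u b =
    (1 + r ^ 2) * (⟪fderiv ℝ X u a, e 0 u⟫ * ⟪fderiv ℝ X u b, e 1 u⟫
      - ⟪fderiv ℝ X u b, e 0 u⟫ * ⟪fderiv ℝ X u a, e 1 u⟫) := by
  have de : ∀ i, DifferentiableAt ℝ (e i) u := fun i => (he i).differentiableAt (by simp)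
  have d2 : DifferentiableAt ℝ (fderiv ℝ (e 1)) u :=
    ((he 1).fderiv_right (m := 1) (by norm_num)).differentiableAt (by simp)
  -- The last term is symmetric in `v, w`, so it drops out of the exterior derivative.
  have expand : ∀ v w, fderiv ℝ (fun y => ⟪fderiv ℝ (e 1) y w, e 0 y⟫) u v =
      ⟪fderiv ℝ (e 1) u w, fderiv ℝ (e 0) u v⟫ + ⟪fderiv ℝ (fderiv ℝ (e 1)) u v w, e 0 u⟫ := by
    intro v w
    have hw : HasFDerivAt (fun y => fderiv ℝ (e 1) y w)
        ((fderiv ℝ (fderiv ℝ (e 1)) u).flip w) u := by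
      simpa using d2.hasFDerivAt.clm_apply (hasFDerivAt_const w u)
    rw [fderiv_inner_apply ℝ hw.differentiableAt (de 0), hw.fderiv]
    rfl
  have sym := (he 1).isSymmSndFDerivAt (by simp)
  have heN : ∀ i, ∀ y ∈ U, ⟪e i y, N y⟫ = 0 := by
    intro i y hy
    obtain ⟨w, hw⟩ := het y hy i
    rw [← hw, real_inner_comm, h.inner_normal_fderiv y hy]
  have heX : ∀ i, ∀ y ∈ U, ⟪e i y, X y⟫ = 0 := by
    intro i y hy
    obtain ⟨w, hw⟩ := het y hy i
    rw [← hw]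
    exact inner_fderiv_self_eq_zero h.isOpen h.inner_pos_pos hy (h.differentiableAt_pos hy) w
  have h_dN : ∀ i v, ⟪fderiv ℝ (e i) u v, N u⟫ = r * ⟪fderiv ℝ X u v, e i u⟫ := by
    intro i v
    have := inner_fderiv_add_inner_fderiv_eq_zero h.isOpen (heN i) hu (de i)
      (h.differentiableAt_normal hu) v
    rw [hr] at this
    simp only [smul_apply, real_inner_smul_right,
      real_inner_comm (fderiv ℝ X u v)] at this
    linarith
  have h_dX : ∀ i v, ⟪fderiv ℝ (e i) u v, X u⟫ = -⟪fderiv ℝ X u v, e i u⟫ := by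
    intro i v
    have := inner_fderiv_add_inner_fderiv_eq_zero h.isOpen (heX i) hu (de i)
      (h.differentiableAt_pos hu) v
    rw [real_inner_comm] at this
    linarith
  have d00 := inner_fderiv_self_eq_zero h.isOpen h00 hu (de 0)
  have d11 := inner_fderiv_self_eq_zero h.isOpen h11 hu (de 1)
  -- Of the four Parseval terms, those along `e 0` and `e 1` vanish by `d00` and `d11`; `N` gives
  -- the factor `r ^ 2` and `X` the factor `(-1) * (-1)`.
  have key : ∀ v w, ⟪fderiv ℝ (e 1) u w, fderiv ℝ (e 0) u v⟫ =
      (1 + r ^ 2) * (⟪fderiv ℝ X u v, e 0 u⟫ * ⟪fderiv ℝ X u w, e 1 u⟫) := by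
    intro v w
    rw [inner_eq_of_four (h00 u hu) (h11 u hu) (h.inner_normal_normal u hu)
      (h.inner_pos_pos u hu) (h01 u hu) (heN 0 u hu) (heX 0 u hu) (heN 1 u hu) (heX 1 u hu)
      (h.inner_normal_pos u hu) (fderiv ℝ (e 1) u w) (fderiv ℝ (e 0) u v),
      d00, d11, h_dN, h_dN, h_dX, h_dX]
    ring
  rw [expand, expand, sym a b, key, key]
  ring

end IsPatch

/-! ### The Gram-Schmidt frame. -/

lemma linearIndependent_apply_coord {A : E2 →L[ℝ] E4} (hA : Function.Injective A) :
    LinearIndependent ℝ fun j => A (coord j) := by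
  have : LinearIndependent ℝ (coord : Fin 2 → E2) := by
    have hc : (coord : Fin 2 → E2) = (EuclideanSpace.basisFun (Fin 2) ℝ).toBasis := by
      ext1 i
      simp [coord]
    rw [hc]
    exact (EuclideanSpace.basisFun (Fin 2) ℝ).toBasis.linearIndependent
  exact this.map' A.toLinearMap (LinearMap.ker_eq_bot.mpr hA)

open InnerProductSpace in
lemma gramSchmidtNormed_mem_range {A : E2 →L[ℝ] E4} (i : Fin 2) :
    gramSchmidtNormed ℝ (fun j => A (coord j)) i ∈ Set.range A := by
  have h1 : gramSchmidtNormed ℝ (fun j => A (coord j)) i ∈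
      Submodule.span ℝ (Set.range (gramSchmidtNormed ℝ fun j => A (coord j))) :=
    Submodule.subset_span ⟨i, rfl⟩
  rw [span_gramSchmidtNormed_range, span_gramSchmidt] at h1
  have h2 : Submodule.span ℝ (Set.range fun j => A (coord j)) ≤ LinearMap.range A.toLinearMap := by
    rw [Submodule.span_le]
    rintro _ ⟨j, rfl⟩
    exact ⟨coord j, rfl⟩
  exact h2 h1

-- For two vectors the process is an explicit formula, whose denominators are nonzero by linear
-- independence.
open InnerProductSpace in
lemma contDiffAt_gramSchmidtNormed {n : ℕ∞ω} {f : Fin 2 → E2 → E4} {u : E2}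
    (hf : ∀ i, ContDiffAt ℝ n (f i) u) (hli : LinearIndependent ℝ fun i => f i u) (i : Fin 2) :
    ContDiffAt ℝ n (fun y => gramSchmidtNormed ℝ (fun j => f j y) i) u := by
  have h0 : ∀ y, gramSchmidt ℝ (fun j => f j y) 0 = f 0 y := fun y => gramSchmidt_bot ℝ _
  have h1 : ∀ y, gramSchmidt ℝ (fun j => f j y) 1 =
      f 1 y - (⟪f 0 y, f 1 y⟫ / ‖f 0 y‖ ^ 2) • f 0 y := by
    intro y
    have := gramSchmidt_def'' ℝ (fun j => f j y) 1
    have hI : Finset.Iio (1 : Fin 2) = {0} := by decide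
    rw [hI, Finset.sum_singleton, h0] at this
    exact eq_sub_of_add_eq this.symm
  have hg : ∀ i, ContDiffAt ℝ n (fun y => gramSchmidt ℝ (fun j => f j y) i) u := by
    intro i
    fin_cases i
    · simpa [h0] using hf 0
    · simp only [Fin.mk_one, h1]
      have hne : ‖f 0 u‖ ^ 2 ≠ 0 := by simpa using hli.ne_zero 0
      exact (hf 1).sub ((((hf 0).inner ℝ (hf 1)).div ((hf 0).norm_sq ℝ) hne).smul (hf 0))
  have hne := gramSchmidt_ne_zero (𝕜 := ℝ) i hli
  simp only [gramSchmidtNormed]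
  exact (((hg i).norm ℝ hne).inv (norm_ne_zero_iff.mpr hne)).smul (hg i)

/-- Multiplied by the determinant of the coordinates of `e₁, e₂` in the coordinate frame, this
determinant becomes that of the Gram matrix of `e₁, e₂`, which is `1`. -/
lemma wedge_ne_zero_of_orthonormal {A : E2 →L[ℝ] E4} {e₁ e₂ : E4} (h₁ : ⟪e₁, e₁⟫ = 1) (h₂ : ⟪e₂, e₂⟫ = 1) (h₁₂ : ⟪e₁, e₂⟫ = 0)
    (m₁ : e₁ ∈ Set.range A) (m₂ : e₂ ∈ Set.range A) :
    ⟪A (coord 0), e₁⟫ * ⟪A (coord 1), e₂⟫ - ⟪A (coord 1), e₁⟫ * ⟪A (coord 0), e₂⟫ ≠ 0 := by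
  obtain ⟨v, rfl⟩ := m₁
  obtain ⟨w, rfl⟩ := m₂
  have dec : ∀ z : E2, z = z 0 • coord 0 + z 1 • coord 1 := by
    intro z
    ext i
    fin_cases i <;> simp [coord]
  have ex : ∀ z y, ⟪A z, y⟫ = z 0 * ⟪A (coord 0), y⟫ + z 1 * ⟪A (coord 1), y⟫ := by
    intro z y
    conv_lhs => rw [dec z]
    simp only [map_add, map_smul, inner_add_left, real_inner_smul_left]
  have a := ex v (A v)
  have b := ex w (A w)
  have c := ex v (A w)
  have d := ex w (A v)
  rw [h₁] at a
  rw [h₂] at b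
  rw [h₁₂] at c
  rw [real_inner_comm, h₁₂] at d
  intro h0
  have : (v 0 * w 1 - v 1 * w 0) * (⟪A (coord 0), A v⟫ * ⟪A (coord 1), A w⟫
      - ⟪A (coord 1), A v⟫ * ⟪A (coord 0), A w⟫) = 1 := by
    linear_combination (v 0 * ⟪A (coord 0), A w⟫ + v 1 * ⟪A (coord 1), A w⟫) * d -
      (w 0 * ⟪A (coord 0), A w⟫ + w 1 * ⟪A (coord 1), A w⟫) * a - b
  rw [h0, mul_zero] at this
  exact zero_ne_one this

/-! ### Passage from charts to the manifold. -/

namespace OrientedSurface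

variable {M : Type*} [TopologicalSpace M] [ChartedSpace E2 M] [IsManifold (𝓡 2) ∞ M]

/-- The differential of a chart representative factors through the manifold derivative. -/
lemma exists_fderiv_comp_extChartAt_symm (p : M) {u : E2} (hu : u ∈ (extChartAt (𝓡 2) p).target) :
    ∃ D : E2 ≃L[ℝ] E2, ∀ f : M → E4, ContMDiff (𝓡 2) 𝓘(ℝ, E4) ∞ f → ∀ v : E2,
      fderiv ℝ (f ∘ (extChartAt (𝓡 2) p).symm) u v =
        mfderiv (𝓡 2) 𝓘(ℝ, E4) f ((extChartAt (𝓡 2) p).symm u) (D v) := by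
  have hinv := isInvertible_mfderivWithin_extChartAt_symm (I := 𝓡 2) hu
  have hmd := mdifferentiableWithinAt_extChartAt_symm (I := 𝓡 2) hu
  rw [ModelWithCorners.range_eq_univ, mfderivWithin_univ] at hinv
  rw [ModelWithCorners.range_eq_univ, mdifferentiableWithinAt_univ] at hmd
  obtain ⟨D, hD⟩ := hinv
  refine ⟨D, fun f hf v => ?_⟩
  have hf' := (hf.mdifferentiable (by simp)) ((extChartAt (𝓡 2) p).symm u)
  have h := mfderiv_comp u hf' hmd
  rw [mfderiv_eq_fderiv, ← hD] at h
  exact congrArg (fun L : E2 →L[ℝ] E4 => L v) h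

lemma isPatch (S : OrientedSurface M) (p : M) :
    IsPatch (extChartAt (𝓡 2) p).target (S.localPos p)
      (S.normal ∘ (extChartAt (𝓡 2) p).symm) where
  isOpen := isOpen_extChartAt_target p
  contDiffOn_pos := by
    rw [← contMDiffOn_iff_contDiffOn]
    exact S.contMDiff_pos.comp_contMDiffOn (contMDiffOn_extChartAt_symm p)
  contDiffOn_normal := by
    rw [← contMDiffOn_iff_contDiffOn]
    exact S.contMDiff_normal.comp_contMDiffOn (contMDiffOn_extChartAt_symm p)
  inner_pos_pos u _ := by
    have := S.pos_mem_sphere ((extChartAt (𝓡 2) p).symm u)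
    rw [mem_sphere_zero_iff_norm] at this
    rw [real_inner_self_eq_norm_sq, localPos, Function.comp_apply, this, one_pow]
  inner_normal_normal u _ := by
    rw [real_inner_self_eq_norm_sq, Function.comp_apply, S.norm_normal, one_pow]
  inner_normal_pos u _ := S.normal_tangent_sphere _
  inner_normal_fderiv u hu v := by
    obtain ⟨D, hD⟩ := exists_fderiv_comp_extChartAt_symm p hu
    rw [localPos, hD S.pos S.contMDiff_pos]
    exact S.normal_orthogonal _ _
  injective u hu := by
    obtain ⟨D, hD⟩ := exists_fderiv_comp_extChartAt_symm p hu
    intro v w hvw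
    rw [localPos, hD S.pos S.contMDiff_pos, hD S.pos S.contMDiff_pos] at hvw
    exact D.injective (S.immersion _ hvw)

/-- One and the same `D` serves `pos` and `normal`, so pulling the principal basis back by `D`
preserves both fundamental forms. -/
lemma fderiv_normal_comp_symm_eq (S : OrientedSurface M) (p : M) {u : E2}
    (hu : u ∈ (extChartAt (𝓡 2) p).target) {r : ℝ}
    (h : S.IsPrincipalCurvatures ((extChartAt (𝓡 2) p).symm u) r r) :
    fderiv ℝ (S.normal ∘ (extChartAt (𝓡 2) p).symm) u = -r • fderiv ℝ (S.localPos p) u := by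
  obtain ⟨D, hD⟩ := exists_fderiv_comp_extChartAt_symm p hu
  obtain ⟨e₁, e₂, ⟨h11, h22, h12⟩, k11, k22, k12, k21⟩ := h
  obtain ⟨v₁, rfl⟩ := D.surjective e₁
  obtain ⟨v₂, rfl⟩ := D.surjective e₂
  simp only [firstForm, secondForm, dpos, dnormal, ← hD S.pos S.contMDiff_pos,
    ← hD S.normal S.contMDiff_normal] at h11 h22 h12 k11 k22 k12 k21
  exact (S.isPatch p).fderiv_normal_eq hu h11 h22 h12 k11 k22 k12 k21

lemma hasMFDerivAt_zero_of_umbilic (S : OrientedSurface M) {lam : M → ℝ}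
    (h : ∀ p, S.IsPrincipalCurvatures p (lam p) (lam p)) (p : M) :
    HasMFDerivAt (𝓡 2) 𝓘(ℝ, ℝ) lam p 0 := by
  have hd := (S.isPatch p).hasFDerivAt_zero_of_umbilic
    (Λ := lam ∘ (extChartAt (𝓡 2) p).symm)
    (fun u hu => S.fderiv_normal_comp_symm_eq p hu (h _)) (mem_extChartAt_target p)
  refine ⟨?_, ?_⟩
  -- Continuity of `lam` is not assumed; it comes from that of its chart representative.
  · have hc : ContinuousAt ((lam ∘ (extChartAt (𝓡 2) p).symm) ∘ extChartAt (𝓡 2) p) p :=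
      hd.continuousAt.comp (continuousAt_extChartAt p)
    refine hc.congr ?_
    filter_upwards [extChartAt_source_mem_nhds (I := 𝓡 2) p] with q hq
    exact congrArg lam ((extChartAt (𝓡 2) p).left_inv hq)
  · exact hd.hasFDerivWithinAt

lemma isLocallyConstant_of_umbilic (S : OrientedSurface M) {lam : M → ℝ}
    (h : ∀ p, S.IsPrincipalCurvatures p (lam p) (lam p)) : IsLocallyConstant lam := by
  rw [IsLocallyConstant.iff_eventually_eq]
  intro p
  have hd : ∀ u ∈ (extChartAt (𝓡 2) p).target,
      HasFDerivAt (lam ∘ (extChartAt (𝓡 2) p).symm) (0 : E2 →L[ℝ] ℝ) u := fun u hu =>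
    (S.isPatch p).hasFDerivAt_zero_of_umbilic
      (fun u hu => S.fderiv_normal_comp_symm_eq p hu (h _)) hu
  -- The chart target may be disconnected, hence the restriction to a ball.
  obtain ⟨ε, hε, hball⟩ := Metric.isOpen_iff.mp (isOpen_extChartAt_target (I := 𝓡 2) p) _
    (mem_extChartAt_target p)
  filter_upwards [extChartAt_source_mem_nhds (I := 𝓡 2) p,
    (continuousAt_extChartAt (I := 𝓡 2) p).preimage_mem_nhds (Metric.ball_mem_nhds _ hε)]
    with q hq hqb
  have := Metric.isOpen_ball.is_const_of_fderiv_eq_zero (𝕜 := ℝ)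
    (convex_ball (extChartAt (𝓡 2) p p) ε).isPreconnected
    (fun u hu => (hd u (hball hu)).differentiableAt.differentiableWithinAt)
    (fun u hu => (hd u (hball hu)).fderiv) hqb (Metric.mem_ball_self hε)
  rwa [Function.comp_apply, Function.comp_apply, (extChartAt (𝓡 2) p).left_inv hq,
    extChartAt_to_inv] at this

open InnerProductSpace in
lemma gaussianCurvature_of_umbilic (S : OrientedSurface M) {p : M} {r : ℝ}
    (h : S.IsPrincipalCurvatures p r r) : S.gaussianCurvature p = 1 + r ^ 2 := by
  have P := S.isPatch p
  have hu := mem_extChartAt_target (I := 𝓡 2) p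
  have hr := S.fderiv_normal_comp_symm_eq p hu (r := r) (by rwa [extChartAt_to_inv])
  have hli := fun y hy => linearIndependent_apply_coord (P.injective y hy)
  have hon := fun y hy => orthonormal_iff_ite.mp (gramSchmidtNormed_orthonormal (hli y hy))
  have h00 : ∀ y ∈ (extChartAt (𝓡 2) p).target, ⟪S.frame p 0 y, S.frame p 0 y⟫ = 1 :=
    fun y hy => (hon y hy 0 0).trans (if_pos rfl)
  have h11 : ∀ y ∈ (extChartAt (𝓡 2) p).target, ⟪S.frame p 1 y, S.frame p 1 y⟫ = 1 :=
    fun y hy => (hon y hy 1 1).trans (if_pos rfl)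
  have h01 : ∀ y ∈ (extChartAt (𝓡 2) p).target, ⟪S.frame p 0 y, S.frame p 1 y⟫ = 0 :=
    fun y hy => (hon y hy 0 1).trans (if_neg zero_ne_one)
  have het : ∀ y ∈ (extChartAt (𝓡 2) p).target, ∀ i,
      S.frame p i y ∈ Set.range (fderiv ℝ (S.localPos p) y) :=
    fun y _ i => gramSchmidtNormed_mem_range i
  have hsm : ∀ i, ContDiffAt ℝ 2 (S.frame p i) (extChartAt (𝓡 2) p p) := fun i =>
    contDiffAt_gramSchmidtNormed (fun j => ((P.contDiffAt_fderiv_pos hu).of_le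
      two_le_smooth).clm_apply contDiffAt_const) (hli _ hu) i
  have hA : S.areaForm p (extChartAt (𝓡 2) p p) ≠ 0 :=
    wedge_ne_zero_of_orthonormal (h00 _ hu) (h11 _ hu) (h01 _ hu) (het _ hu 0) (het _ hu 1)
  rw [gaussianCurvature, div_eq_iff hA, areaForm]
  refine (P.gauss_equation_of_umbilic hu hr hsm h00 h11 h01 het (coord 0) (coord 1)).trans ?_
  simp only [coframe]

end OrientedSurface

end SphereSurface

theorem mainTheorem5 {M : Type*} [TopologicalSpace M] [ChartedSpace SphereSurface.E2 M]
    [IsManifold (𝓡 2) ∞ M] [ConnectedSpace M] (S : SphereSurface.OrientedSurface M)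
    (lam₁ lam₂ : M → ℝ) (hprincipal : ∀ p, S.IsPrincipalCurvatures p (lam₁ p) (lam₂ p))
    (humbilic : ∀ p, lam₁ p = lam₂ p) :
    (∀ p, HasMFDerivAt (𝓡 2) 𝓘(ℝ, ℝ) lam₁ p 0 ∧ HasMFDerivAt (𝓡 2) 𝓘(ℝ, ℝ) lam₂ p 0) ∧
    (∀ p, S.gaussianCurvature p = 1 + lam₁ p * lam₂ p) ∧
    ∃ c : ℝ, (∀ p, lam₁ p = c ∧ lam₂ p = c) ∧ ∀ p, S.gaussianCurvature p = 1 + c ^ 2 := by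
  obtain rfl : lam₁ = lam₂ := funext humbilic
  have hd := S.hasMFDerivAt_zero_of_umbilic hprincipal
  have hK := fun p => S.gaussianCurvature_of_umbilic (hprincipal p)
  refine ⟨fun p => ⟨hd p, hd p⟩, fun p => by rw [hK, sq], ?_⟩
  obtain ⟨p₀⟩ := (inferInstance : Nonempty M)
  have hc := fun p => (S.isLocallyConstant_of_umbilic hprincipal).apply_eq_of_isPreconnected
    isPreconnected_univ (Set.mem_univ p) (Set.mem_univ p₀)
  exact ⟨lam₁ p₀, fun p => ⟨hc p, hc p⟩, fun p => by rw [hK, hc p]⟩
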